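/- Let $X$ be a real Hausdorff locally convex topological vector space with topological dual $X^*$, and let $f,g\colon X\to(-\infty,\infty]$ be convex and proper, i.e. the domains $\operatorname{dom} f:=\{x\in X: f(x)<\infty\}$ and $\operatorname{dom} g$ are nonempty. For a function $h\colon X\to(-\infty,\infty]$ its Fenchel conjugate $h^*\colon X^*\to[-\infty,\infty]$ is $h^*(x^*):=\sup\{\langle x^*,x\rangle-h(x): x\in X\}$, with $\operatorname{dom} h^*:=\{x^*\in X^*: h^*(x^*)<\infty\}$, and the infimal convolution of $f^*$ and $g^*$ is $(f^*\oplus g^*)(x^*):=\inf\{f^*(x_1^*)+g^*(x_2^*): x_1^*,x_2^*\in X^*,\ x_1^*+x_2^*=x^*\}$. Assume that one of the following holds: (i) at least one of the functions $f,g$ is continuous at some point $\bar x\in\operatorname{dom} f\cap\operatorname{dom} g$; or (ii) $X$ is a Banach space, $f$ and $g$ are lower semicontinuous, and $\mathbb R^+(\operatorname{dom} f-\operatorname{dom} g):=\{t(x-y): t>0,\ x\in\operatorname{dom} f,\ y\in\operatorname{dom} g\}$ is a closed linear subspace of $X$. Then $$(f+g)^*(x^*)=(f^*\oplus g^*)(x^*)\quad\text{for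 all }x^*\in X^*.$$ Moreover, in both cases the infimum is attained on $\operatorname{dom}(f+g)^*$: for every $x^*\in\operatorname{dom}(f+g)^*$ there are $x_1^*,x_2^*\in X^*$ with $x^*=x_1^*+x_2^*$ and $(f+g)^*(x^*)=f^*(x_1^*)+g^*(x_2^*)$. -/

import Mathlib

open scoped Pointwise

namespace FenchelSum

/-- The effective domain `dom f = {x | f x < ∞}` of an extended-real-valued function. -/
def effDom {E : Type*} (f : E → EReal) : Set E := {x | f x < ⊤}

/-- A function with values in `(-∞, ∞]` whose effective domain is nonempty. -/
def IsProper {E : Type*} (f : E → EReal) : Prop :=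
  (∀ x, f x ≠ ⊥) ∧ (effDom f).Nonempty

/-- The epigraph `epi f = {(x, μ) ∈ E × ℝ | f x ≤ μ}`. -/
def epigraph {E : Type*} (f : E → EReal) : Set (E × ℝ) := {p | f p.1 ≤ (p.2 : EReal)}

/-- An extended-real-valued function is convex when its epigraph is convex. -/
def IsConvex {E : Type*} [AddCommGroup E] [Module ℝ E] (f : E → EReal) : Prop :=
  Convex ℝ (epigraph f)

/-- The cone `ℝ⁺(Ω) = {t v | t > 0, v ∈ Ω}`. -/
def posCone {E : Type*} [AddCommGroup E] [Module ℝ E] (Ω : Set E) : Set E :=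
  {u | ∃ t : ℝ, 0 < t ∧ ∃ v ∈ Ω, u = t • v}

/-- The set `S` is a (topologically) closed linear subspace of `E`. -/
def IsClosedSubspace {E : Type*} [AddCommGroup E] [Module ℝ E] [TopologicalSpace E]
    (S : Set E) : Prop :=
  IsClosed S ∧ ∃ L : Submodule ℝ E, (L : Set E) = S

/-- The Fenchel conjugate `f*(x*) = sup {⟨x*, x⟩ - f x | x ∈ E}` on the topological dual. -/
noncomputable def conjugate {E : Type*} [AddCommGroup E] [Module ℝ E] [TopologicalSpace E]
    (f : E → EReal) (φ : E →L[ℝ] ℝ) : EReal :=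
  ⨆ x : E, ((φ x : ℝ) : EReal) - f x

/-- The infimal convolution `(f ⊕ g)(x) = inf {f u + g (x - u) | u ∈ E}`. -/
noncomputable def infConv {E : Type*} [AddCommGroup E] (f g : E → EReal) (x : E) : EReal :=
  ⨅ u : E, f u + g (x - u)

/-- The conjugate sum rule with attainment: `(f + g)* = f* ⊕ g*` on the whole dual, and for every
`x* ∈ dom (f + g)*` the infimum in the infimal convolution is attained. -/
def ExactConjugateSumRule {E : Type*} [AddCommGroup E] [Module ℝ E] [TopologicalSpace E]
    [IsTopologicalAddGroup E] (f g : E → EReal) : Prop :=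
  (∀ φ : E →L[ℝ] ℝ, conjugate (f + g) φ = infConv (conjugate f) (conjugate g) φ) ∧
  ∀ φ ∈ effDom (conjugate (f + g)), ∃ φ₁ φ₂ : E →L[ℝ] ℝ,
    φ = φ₁ + φ₂ ∧ conjugate (f + g) φ = conjugate f φ₁ + conjugate g φ₂

end FenchelSum

open Filter Topology

/-! Fenchel–Young gives `(f + g)* ≤ f* ⊕ g*`. For the converse with attainment, fix `φ` and a real
`m ≥ (f + g)* φ`, and let `v z = inf {f x + g y - φ y | x - y = z}`. Then `v` is convex with `v 0 ≥
-m`, and `ψ - m` minorizes `v` exactly when `f* ψ + g* (φ - ψ) ≤ m`. Hahn–Banach separation supplies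
`ψ` once `v` is bounded above near 0 (`exists_affine_minorant`). In case (i) continuity gives that
bound. In case (ii) it holds on the closed subspace, by Baire and a Robinson–Ursescu series argument
(`eventually_exists_sub_eq`); `ψ` is then extended to the whole space. -/

/-- A convex set of `X × ℝ` that lies above height `m` over the origin and is bounded above near the
origin lies above the graph of a continuous affine function with value `m` at the origin. -/
theorem exists_affine_minorant {X : Type*} [AddCommGroup X] [Module ℝ X] [TopologicalSpace X]
    [IsTopologicalAddGroup X] [ContinuousSMul ℝ X] {D : Set (X × ℝ)}
    (hD : Convex ℝ D) (hup : ∀ z r s, (z, r) ∈ D → r ≤ s → (z, s) ∈ D) {m : ℝ}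
    (hm : ∀ r, ((0 : X), r) ∈ D → m ≤ r) {M : ℝ} (hM : ∀ᶠ z in 𝓝 (0 : X), (z, M) ∈ D) :
    ∃ ψ : X →L[ℝ] ℝ, ∀ z r, (z, r) ∈ D → ψ z + m ≤ r := by
  -- Height `M` itself may lie on the boundary; one unit more leaves room for a product
  -- neighbourhood.
  have hint : ((0 : X), M + 1) ∈ interior D := by
    rw [mem_interior_iff_mem_nhds, nhds_prod_eq]
    filter_upwards [hM.prod_mk (lt_mem_nhds (lt_add_one M))] with p hp
    exact hup _ _ _ hp.1 hp.2.le
  have hnot : ((0 : X), m) ∉ interior D := by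
    intro h
    rw [mem_interior_iff_mem_nhds] at h
    have hc : Tendsto (fun r : ℝ => ((0 : X), r)) (𝓝[<] m) (𝓝 ((0 : X), m)) :=
      ((by fun_prop : Continuous fun r : ℝ => ((0 : X), r)).tendsto m).mono_left
        nhdsWithin_le_nhds
    obtain ⟨r, hr, hrm⟩ := ((hc.eventually h).and self_mem_nhdsWithin).exists
    exact absurd (hm r hr) (not_le.2 hrm)
  obtain ⟨F, hF⟩ := geometric_hahn_banach_open_point hD.interior isOpen_interior hnot
  have hFle : ∀ p ∈ D, F p ≤ F (0, m) := by
    intro p hp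
    have hcl : p ∈ closure (interior D) := by
      rw [hD.closure_interior_eq_closure_of_nonempty_interior ⟨_, hint⟩]
      exact subset_closure hp
    exact closure_minimal (fun q hq => (hF q hq).le)
      (isClosed_le F.continuous continuous_const) hcl
  have hsplit : ∀ z r, F (z, r) = F (z, 0) + r * F (0, 1) := by
    intro z r
    have : ((z, r) : X × ℝ) = (z, 0) + r • (0, 1) := by ext <;> simp
    rw [this, map_add, map_smul, smul_eq_mul]
  -- The hyperplane is not vertical: `F` strictly separates two points over the same base point 0.
  have hc : F (0, 1) < 0 := by
    have h1 := hF _ hint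
    have h2 := hm _ (interior_subset hint)
    have h3 : m ≤ M := hm _ hM.self_of_nhds
    rw [hsplit 0 (M + 1), hsplit 0 m] at h1
    nlinarith
  refine ⟨(-(F (0, 1))⁻¹) • F.comp (ContinuousLinearMap.inl ℝ X ℝ), fun z r hz => ?_⟩
  have h := hFle _ hz
  have h0 : F ((0 : X), (0 : ℝ)) = 0 := map_zero F
  rw [hsplit z r, hsplit 0 m, h0] at h
  simp only [smul_apply, ContinuousLinearMap.comp_apply,
    ContinuousLinearMap.inl_apply, smul_eq_mul]
  have hk : 0 < -(F (0, 1))⁻¹ := neg_pos.2 (inv_lt_zero.2 hc)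
  have h4 := mul_le_mul_of_nonneg_left h hk.le
  have h5 : (F (0, 1))⁻¹ * F (0, 1) = 1 := inv_mul_cancel₀ hc.ne
  linear_combination h4 + (r - m) * h5

/-! ### Open mapping for closed convex relations -/

/-- A convex subset of a real Banach space that absorbs every vector has closure a neighbourhood of
the origin. -/
theorem closure_mem_nhds_zero_of_absorbing {F : Type*} [NormedAddCommGroup F] [NormedSpace ℝ F]
    [CompleteSpace F] {T : Set F} (hT : Convex ℝ T)
    (habs : ∀ z : F, ∃ t : ℝ, 0 < t ∧ t • z ∈ T) : closure T ∈ 𝓝 (0 : F) := by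
  have h0 : (0 : F) ∈ T := by
    obtain ⟨t, -, ht⟩ := habs 0
    simpa using ht
  obtain ⟨n, hn⟩ := nonempty_interior_of_iUnion_of_closed
    (f := fun n : ℕ => ((n : ℝ) + 1) • closure T)
    (fun n => isClosed_closure.smul_of_ne_zero (by positivity)) (by
      refine Set.eq_univ_of_forall fun z => Set.mem_iUnion.2 ?_
      obtain ⟨t, ht, htz⟩ := habs z
      obtain ⟨n, hn⟩ := exists_nat_one_div_lt ht
      have hn0 : (0 : ℝ) < n + 1 := by positivity
      refine ⟨n, (Set.mem_smul_set_iff_inv_smul_mem₀ hn0.ne' _ _).2 (subset_closure ?_)⟩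
      have := hT.smul_mem_of_zero_mem h0 htz (t := (1 / ((n : ℝ) + 1)) / t)
        ⟨by positivity, (div_le_one ht).2 hn.le⟩
      rwa [smul_smul, div_mul_cancel₀ _ ht.ne', one_div] at this)
  rw [interior_smul₀ (by positivity)] at hn
  obtain ⟨z, hz⟩ := Set.smul_set_nonempty.1 hn
  obtain ⟨t, ht, htz⟩ := habs (-z)
  rw [← mem_interior_iff_mem_nhds]
  -- The weights make the combination of the interior point `z` and `-t • z` equal to 0.
  have := hT.closure.combo_interior_self_mem_interior hz (subset_closure htz)
    (a := t / (1 + t)) (b := 1 / (1 + t)) (by positivity) (by positivity) (by field_simp; ring)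
  convert this using 1
  rw [smul_neg, smul_neg, smul_smul, one_div_mul_eq_div, add_neg_cancel]

/-- The Robinson–Ursescu theorem for a closed convex relation with bounded domain. -/
theorem snd_image_mem_nhds_zero {E F : Type*} [NormedAddCommGroup E] [NormedSpace ℝ E]
    [CompleteSpace E] [NormedAddCommGroup F] [NormedSpace ℝ F] [CompleteSpace F]
    {G : Set (E × F)} (hG : Convex ℝ G) (hcl : IsClosed G) {R : ℝ} (hR : ∀ p ∈ G, ‖p.1‖ ≤ R)
    (habs : ∀ z : F, ∃ t : ℝ, 0 < t ∧ t • z ∈ Prod.snd '' G) :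
    Prod.snd '' G ∈ 𝓝 (0 : F) := by
  have hconv : Convex ℝ (Prod.snd '' G) := hG.linear_image (LinearMap.snd ℝ E F)
  obtain ⟨r, hr, hball⟩ := Metric.mem_nhds_iff.1 (closure_mem_nhds_zero_of_absorbing hconv habs)
  have happrox : ∀ w : F, ‖w‖ < r → ∃ p ∈ G, ‖(2 : ℝ) • (w - p.2)‖ < r := by
    intro w hw
    obtain ⟨_, ⟨p, hp, rfl⟩, hlt⟩ :=
      Metric.mem_closure_iff.1 (hball (mem_ball_zero_iff.2 hw)) (r / 2) (half_pos hr)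
    refine ⟨p, hp, ?_⟩
    rw [dist_eq_norm] at hlt
    rw [norm_smul, Real.norm_ofNat]
    linarith
  choose! q hqG hq using happrox
  have hmain : ∀ w : F, ‖w‖ < r → (1 / 2 : ℝ) • w ∈ Prod.snd '' G := by
    intro w hw
    -- `W n` is the residual after `n` approximations, doubled each time so that it stays in the
    -- ball.
    let W : ℕ → F := fun n => (fun w => (2 : ℝ) • (w - (q w).2))^[n] w
    have hWs : ∀ n, W (n + 1) = (2 : ℝ) • (W n - (q (W n)).2) := fun n =>
      Function.iterate_succ_apply' _ _ _
    have hWr : ∀ n, ‖W n‖ < r := by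
      intro n
      induction n with
      | zero => exact hw
      | succ n ih => rw [hWs]; exact hq _ ih
    have hpG : ∀ n, q (W n) ∈ G := fun n => hqG _ (hWr n)
    let P : ℕ → E × F := fun n => ∑ k ∈ Finset.range n, (1 / 2 : ℝ) ^ (k + 1) • q (W k)
    -- The weights in `P n` sum to `1 - (1/2)^n`; the missing mass may go to any point of `G`.
    have hPG : ∀ n, ∀ b ∈ G, P n + (1 / 2 : ℝ) ^ n • b ∈ G := by
      intro n
      induction n with
      | zero => intro b hb; simpa [P] using hb
      | succ n ih =>
        intro b hb
        have := ih _ (hG (hpG n) hb (a := 1 / 2) (b := 1 / 2) (by norm_num) (by norm_num)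
          (by norm_num))
        convert this using 1
        simp only [P, Finset.sum_range_succ, smul_add, smul_smul, pow_succ]
        rw [add_assoc]
    have hP2 : ∀ n, (P n).2 = (1 / 2 : ℝ) • w - (1 / 2 : ℝ) ^ (n + 1) • W n := by
      intro n
      induction n with
      | zero => simp [P, W]
      | succ n ih =>
        have : P (n + 1) = P n + (1 / 2 : ℝ) ^ (n + 1) • q (W n) := Finset.sum_range_succ _ _
        rw [this, Prod.snd_add, ih, Prod.smul_snd, hWs, pow_succ _ (n + 1), mul_smul, smul_smul (1 / 2)]
        norm_num
        module
    have hgeo : Tendsto (fun n : ℕ => (1 / 2 : ℝ) ^ n) atTop (𝓝 0) :=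
      tendsto_pow_atTop_nhds_zero_of_lt_one (by norm_num) (by norm_num)
    have hsum : Summable fun k => (1 / 2 : ℝ) ^ (k + 1) • (q (W k)).1 := by
      refine Summable.of_norm_bounded (g := fun k => (1 / 2 : ℝ) ^ (k + 1) * R)
        (((summable_nat_add_iff 1).2 summable_geometric_two).mul_right R) fun k => ?_
      rw [norm_smul, norm_pow, Real.norm_of_nonneg (by norm_num : (0 : ℝ) ≤ 1 / 2)]
      exact mul_le_mul_of_nonneg_left (hR _ (hpG k)) (by positivity)
    have hP1 : Tendsto (fun n => (P n).1) atTop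
        (𝓝 (∑' k, (1 / 2 : ℝ) ^ (k + 1) • (q (W k)).1)) := by
      have := hsum.hasSum.tendsto_sum_nat
      refine this.congr fun n => ?_
      simp only [P, Prod.fst_sum, Prod.smul_fst]
    have hP2' : Tendsto (fun n => (P n).2) atTop (𝓝 ((1 / 2 : ℝ) • w)) := by
      have hz : Tendsto (fun n => (1 / 2 : ℝ) ^ (n + 1) • W n) atTop (𝓝 0) := by
        refine ((tendsto_add_atTop_iff_nat 1).2 hgeo).zero_smul_isBoundedUnder_le ?_
        exact isBoundedUnder_of ⟨r, fun n => (hWr n).le⟩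
      simpa [hP2] using tendsto_const_nhds.sub hz
    have hlim := (hP1.prodMk_nhds hP2').add (hgeo.smul_const (q w))
    rw [zero_smul, add_zero] at hlim
    exact ⟨_, hcl.mem_of_tendsto hlim
      (Eventually.of_forall fun n => hPG n _ (hqG w hw)), rfl⟩
  refine Metric.mem_nhds_iff.2 ⟨r / 2, half_pos hr, fun z hz => ?_⟩
  have := hmain ((2 : ℝ) • z) (by
    rw [norm_smul, Real.norm_ofNat]
    have := mem_ball_zero_iff.1 hz
    linarith)
  simpa [smul_smul] using this

namespace FenchelSum

/-! ### Conjugates and extended-real arithmetic -/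

theorem add_ne_bot {E : Type*} {f g : E → EReal} (hf : ∀ x, f x ≠ ⊥) (hg : ∀ x, g x ≠ ⊥) (x : E) :
    (f + g) x ≠ ⊥ := by
  rw [Pi.add_apply, Ne, EReal.add_eq_bot_iff]
  exact not_or.2 ⟨hf x, hg x⟩

theorem exists_coe_le_of_add_le {u v : EReal} (hu : u ≠ ⊥) (hv : v ≠ ⊥) {c : ℝ}
    (h : u + v ≤ c) : ∃ a b : ℝ, u ≤ a ∧ v ≤ b ∧ a + b = c := by
  induction u with
  | bot => exact absurd rfl hu
  | top => rw [EReal.top_add_of_ne_bot hv] at h; exact absurd h (by simp)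
  | coe a =>
    refine ⟨a, c - a, le_rfl, ?_, by ring⟩
    induction v with
    | bot => exact absurd rfl hv
    | top => rw [EReal.add_top_of_ne_bot hu] at h; exact absurd h (by simp)
    | coe b =>
      rw [← EReal.coe_add, EReal.coe_le_coe_iff] at h
      exact EReal.coe_le_coe_iff.2 (by linarith)

section

variable {E : Type*} [AddCommGroup E] [Module ℝ E] [TopologicalSpace E]

theorem conjugate_ne_bot {f : E → EReal} (hf : IsProper f) (φ : E →L[ℝ] ℝ) :
    conjugate f φ ≠ ⊥ := by
  obtain ⟨x, hx⟩ := hf.2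
  have h : ((φ x : ℝ) : EReal) - f x ≤ conjugate f φ := le_iSup (fun x => ((φ x : ℝ) : EReal) - f x) x
  have hx' : f x < ⊤ := hx
  lift f x to ℝ using ⟨hx'.ne, hf.1 x⟩ with a
  rw [← EReal.coe_sub] at h
  exact ((EReal.bot_lt_coe _).trans_le h).ne'

/-- Ranging over points of the epigraph keeps the arithmetic real; points where `f = ⊤` contribute
nothing. -/
theorem conjugate_le_coe_iff {f : E → EReal} (hf : ∀ x, f x ≠ ⊥) (φ : E →L[ℝ] ℝ) (m : ℝ) :
    conjugate f φ ≤ m ↔ ∀ x (a : ℝ), f x ≤ a → φ x - a ≤ m := by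
  rw [conjugate, iSup_le_iff]
  refine forall_congr' fun x => ?_
  have hx := hf x
  generalize f x = y at hx
  induction y with
  | bot => exact absurd rfl hx
  | top => simp
  | coe b =>
    rw [← EReal.coe_sub, EReal.coe_le_coe_iff]
    refine ⟨fun h a ha => ?_, fun h => h b le_rfl⟩
    have := EReal.coe_le_coe_iff.1 ha
    linarith

/-- The Fenchel–Young inequality. -/
theorem sub_le_of_conjugate_le {f : E → EReal} (φ : E →L[ℝ] ℝ) (m : ℝ)
    (h : conjugate f φ ≤ m) (hf : ∀ x, f x ≠ ⊥) {x : E} {a : ℝ} (ha : f x ≤ a) : φ x - a ≤ m :=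
  (conjugate_le_coe_iff hf φ m).1 h x a ha

theorem conjugate_add_le [IsTopologicalAddGroup E] {f g : E → EReal} (hf : IsProper f)
    (hg : IsProper g) (φ₁ φ₂ : E →L[ℝ] ℝ) :
    conjugate (f + g) (φ₁ + φ₂) ≤ conjugate f φ₁ + conjugate g φ₂ := by
  refine EReal.le_of_forall_lt_iff_le.1 fun c hc => ?_
  obtain ⟨a, b, ha, hb, rfl⟩ := exists_coe_le_of_add_le (conjugate_ne_bot hf φ₁)
    (conjugate_ne_bot hg φ₂) hc.le
  rw [conjugate_le_coe_iff (add_ne_bot hf.1 hg.1)]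
  intro x s hs
  obtain ⟨u, v, hu, hv, rfl⟩ := exists_coe_le_of_add_le (hf.1 x) (hg.1 x) hs
  have h1 := sub_le_of_conjugate_le φ₁ a ha hf.1 hu
  have h2 := sub_le_of_conjugate_le φ₂ b hb hg.1 hv
  simp only [add_apply]
  linarith

/-- The exact sum rule follows once every real upper bound of `(f + g)*` can be split. -/
theorem exactConjugateSumRule_of_split [IsTopologicalAddGroup E] {f g : E → EReal}
    (hf : IsProper f) (hg : IsProper g) (hfg : (effDom f ∩ effDom g).Nonempty)
    (h : ∀ (φ : E →L[ℝ] ℝ) (m : ℝ), conjugate (f + g) φ ≤ m →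
      ∃ φ₁ φ₂ : E →L[ℝ] ℝ, φ = φ₁ + φ₂ ∧ conjugate f φ₁ + conjugate g φ₂ ≤ m) :
    ExactConjugateSumRule f g := by
  have hproper : IsProper (f + g) := by
    refine ⟨add_ne_bot hf.1 hg.1, ?_⟩
    obtain ⟨x, hxf, hxg⟩ := hfg
    exact ⟨x, EReal.add_lt_top (ne_of_lt hxf) (ne_of_lt hxg)⟩
  have hatt : ∀ φ ∈ effDom (conjugate (f + g)), ∃ φ₁ φ₂ : E →L[ℝ] ℝ,
      φ = φ₁ + φ₂ ∧ conjugate (f + g) φ = conjugate f φ₁ + conjugate g φ₂ := by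
    intro φ hφ
    have hcoe := EReal.coe_toReal (ne_of_lt hφ) (conjugate_ne_bot hproper φ)
    obtain ⟨φ₁, φ₂, rfl, hle⟩ := h φ _ hcoe.ge
    rw [hcoe] at hle
    exact ⟨φ₁, φ₂, rfl, (conjugate_add_le hf hg φ₁ φ₂).antisymm hle⟩
  refine ⟨fun φ => le_antisymm (le_iInf fun ψ => ?_) ?_, hatt⟩
  · simpa using conjugate_add_le hf hg ψ (φ - ψ)
  · by_cases hφ : φ ∈ effDom (conjugate (f + g))
    · obtain ⟨φ₁, φ₂, hsum, heq⟩ := hatt φ hφ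
      rw [heq]
      refine (iInf_le _ φ₁).trans_eq ?_
      rw [hsum, add_sub_cancel_left]
    · exact le_top.trans (not_lt.1 hφ)

/-! ### Perturbation function and the continuous case -/

/-- The epigraph of the perturbation function
`z ↦ inf {f x + g y - φ y | x - y = z}`, without closing the infimum. -/
def perturbation (f g : E → EReal) (φ : E →L[ℝ] ℝ) : Set (E × ℝ) :=
  {p | ∃ x y : E, ∃ a b : ℝ, f x ≤ a ∧ g y ≤ b ∧ p.1 = x - y ∧ a + b - φ y = p.2}

theorem convex_perturbation {f g : E → EReal} (hf : IsConvex f) (hg : IsConvex g)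
    (φ : E →L[ℝ] ℝ) : Convex ℝ (perturbation f g φ) := by
  rintro ⟨_, _⟩ ⟨x, y, a, b, ha, hb, rfl, rfl⟩ ⟨_, _⟩ ⟨x', y', a', b', ha', hb', rfl, rfl⟩
    s t hs ht hst
  refine ⟨s • x + t • x', s • y + t • y', s * a + t * a', s * b + t * b', ?_, ?_, ?_, ?_⟩
  · exact hf (x := (x, a)) ha (y := (x', a')) ha' hs ht hst
  · exact hg (x := (y, b)) hb (y := (y', b')) hb' hs ht hst
  · simp only [Prod.smul_mk, Prod.mk_add_mk]
    module
  · simp only [Prod.smul_mk, Prod.mk_add_mk, map_add, map_smul, smul_eq_mul]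
    ring

theorem perturbation_mono {f g : E → EReal} {φ : E →L[ℝ] ℝ} (z : E) (r s : ℝ)
    (h : (z, r) ∈ perturbation f g φ) (hrs : r ≤ s) : (z, s) ∈ perturbation f g φ := by
  obtain ⟨x, y, a, b, ha, hb, hz, hr⟩ := h
  refine ⟨x, y, a + (s - r), b, ha.trans (EReal.coe_le_coe_iff.2 (by linarith)), hb, hz, ?_⟩
  simp only at hr ⊢
  linarith

theorem neg_le_of_zero_mem_perturbation {f g : E → EReal} (hf : ∀ x, f x ≠ ⊥)
    (hg : ∀ x, g x ≠ ⊥) {φ : E →L[ℝ] ℝ} {m : ℝ} (hm : conjugate (f + g) φ ≤ m) (r : ℝ)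
    (h : ((0 : E), r) ∈ perturbation f g φ) : -m ≤ r := by
  obtain ⟨x, y, a, b, ha, hb, hz, rfl⟩ := h
  obtain rfl : x = y := sub_eq_zero.1 hz.symm
  have := sub_le_of_conjugate_le φ m hm (add_ne_bot hf hg) (x := x) (a := a + b)
    (by rw [EReal.coe_add]; exact add_le_add ha hb)
  linarith

/-- The hypothesis decouples into a term in `x` plus a term in `y`, so the two suprema can be taken
separately; properness of `f` makes the conjugate of `g` finite here. -/
theorem conjugate_add_conjugate_le_of_perturbation [IsTopologicalAddGroup E] {f g : E → EReal}
    (hf : IsProper f) (hg : IsProper g) {φ ψ : E →L[ℝ] ℝ} {m : ℝ}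
    (h : ∀ z r, (z, r) ∈ perturbation f g φ → ψ z + -m ≤ r) :
    conjugate f ψ + conjugate g (φ - ψ) ≤ m := by
  have key : ∀ x y (a b : ℝ), f x ≤ a → g y ≤ b → ψ x - a + ((φ - ψ) y - b) ≤ m := by
    intro x y a b ha hb
    have := h (x - y) (a + b - φ y) ⟨x, y, a, b, ha, hb, rfl, rfl⟩
    rw [map_sub] at this
    rw [sub_apply]
    linarith
  have hg' : conjugate g (φ - ψ) ≠ ⊤ := by
    obtain ⟨x, hx⟩ := hf.2
    have hle : conjugate g (φ - ψ) ≤ ((m - (ψ x - (f x).toReal) : ℝ) : EReal) := by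
      rw [conjugate_le_coe_iff hg.1]
      intro y b hb
      have := key x y _ b (EReal.coe_toReal (ne_of_lt hx) (hf.1 x)).ge hb
      linarith
    exact (hle.trans_lt (EReal.coe_lt_top _)).ne
  have hcoe := EReal.coe_toReal hg' (conjugate_ne_bot hg _)
  set c := (conjugate g (φ - ψ)).toReal
  have hle : conjugate f ψ ≤ ((m - c : ℝ) : EReal) := by
    rw [conjugate_le_coe_iff hf.1]
    intro x a ha
    have : conjugate g (φ - ψ) ≤ ((m - (ψ x - a) : ℝ) : EReal) := by
      rw [conjugate_le_coe_iff hg.1]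
      intro y b hb
      have := key x y a b ha hb
      linarith
    rw [← hcoe, EReal.coe_le_coe_iff] at this
    linarith
  calc conjugate f ψ + conjugate g (φ - ψ) ≤ ((m - c : ℝ) : EReal) + (c : EReal) :=
        add_le_add hle hcoe.ge
    _ = m := by rw [← EReal.coe_add, sub_add_cancel]

/-- Splitting of a functional when the first function is continuous at a common point of the
domains. -/
theorem exists_split_of_continuousAt [IsTopologicalAddGroup E] [ContinuousSMul ℝ E]
    {f g : E → EReal} (hf : IsProper f) (hg : IsProper g) (hfc : IsConvex f) (hgc : IsConvex g)
    {x : E} (hxf : x ∈ effDom f) (hxg : x ∈ effDom g) (hx : ContinuousAt f x)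
    (φ : E →L[ℝ] ℝ) (m : ℝ) (hm : conjugate (f + g) φ ≤ m) :
    ∃ φ₁ φ₂ : E →L[ℝ] ℝ, φ = φ₁ + φ₂ ∧ conjugate f φ₁ + conjugate g φ₂ ≤ m := by
  obtain ⟨M, hM, -⟩ := EReal.lt_iff_exists_real_btwn.1 (show f x < ⊤ from hxf)
  have hb := (EReal.coe_toReal (ne_of_lt hxg) (hg.1 x)).ge
  have hnear : ∀ᶠ z in 𝓝 (0 : E), f (x + z) < M := by
    have ht : Tendsto (fun z : E => x + z) (𝓝 0) (𝓝 x) := by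
      simpa using (tendsto_id (x := 𝓝 (0 : E))).const_add x
    exact ht.eventually (hx.eventually (gt_mem_nhds hM))
  -- Keep the argument of `g` fixed at `x` and move only that of `f`.
  obtain ⟨ψ, hψ⟩ := exists_affine_minorant (convex_perturbation hfc hgc φ) perturbation_mono
    (neg_le_of_zero_mem_perturbation hf.1 hg.1 hm) (M := M + (g x).toReal - φ x)
    (hnear.mono fun z hz => ⟨x + z, x, M, _, hz.le, hb, by simp, rfl⟩)
  exact ⟨ψ, φ - ψ, by abel, conjugate_add_conjugate_le_of_perturbation hf hg hψ⟩

theorem exactConjugateSumRule_of_continuousAt [IsTopologicalAddGroup E] [ContinuousSMul ℝ E]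
    {f g : E → EReal} (hf : IsProper f) (hg : IsProper g) (hfc : IsConvex f) (hgc : IsConvex g)
    (h : ∃ x ∈ effDom f ∩ effDom g, ContinuousAt f x ∨ ContinuousAt g x) :
    ExactConjugateSumRule f g := by
  obtain ⟨x, ⟨hxf, hxg⟩, hx | hx⟩ := h
  · exact exactConjugateSumRule_of_split hf hg ⟨x, hxf, hxg⟩
      (exists_split_of_continuousAt hf hg hfc hgc hxf hxg hx)
  · refine exactConjugateSumRule_of_split hf hg ⟨x, hxf, hxg⟩ fun φ m hm => ?_
    rw [add_comm f g] at hm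
    obtain ⟨φ₁, φ₂, hφ, hle⟩ := exists_split_of_continuousAt hg hf hgc hfc hxg hxf hx φ m hm
    exact ⟨φ₂, φ₁, hφ.trans (add_comm _ _), (add_comm _ _).trans_le hle⟩

end

/-! ### The Banach space case -/

theorem IsConvex.convex_sublevel {E : Type*} [AddCommGroup E] [Module ℝ E] {f : E → EReal}
    (hf : IsConvex f) (c : ℝ) : Convex ℝ {x | f x ≤ c} := by
  intro x hx y hy s t hs ht hst
  have := hf (x := (x, c)) hx (y := (y, c)) hy hs ht hst
  simpa [epigraph, ← add_mul, hst] using this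

/-- A convex function stays below any bound exceeding its value at `x` along an initial part of
each segment from `x` inside its domain. -/
theorem IsConvex.eventually_le {E : Type*} [AddCommGroup E] [Module ℝ E] {f : E → EReal}
    (hf : IsConvex f) {x y : E} {a b : ℝ} (hx : f x ≤ a) (hy : f y ≤ b) {c : ℝ} (hc : a < c) :
    ∀ᶠ t : ℝ in 𝓝[>] 0, f ((1 - t) • x + t • y) ≤ c := by
  have hlim : Tendsto (fun t : ℝ => (1 - t) * a + t * b) (𝓝[>] 0) (𝓝 a) := by
    have : Continuous fun t : ℝ => (1 - t) * a + t * b := by fun_prop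
    simpa using (this.tendsto 0).mono_left nhdsWithin_le_nhds
  have h1 : ∀ᶠ t : ℝ in 𝓝[>] 0, t < 1 := nhdsWithin_le_nhds (gt_mem_nhds one_pos)
  filter_upwards [hlim.eventually (gt_mem_nhds hc), h1, self_mem_nhdsWithin] with t ht ht1 ht0
  have h := hf (x := (x, a)) hx (y := (y, b)) hy (sub_nonneg.2 ht1.le) (le_of_lt ht0)
    (sub_add_cancel 1 t)
  exact le_trans h (EReal.coe_le_coe_iff.2 ht.le)

/-- Under the closed-subspace condition, the difference of a bounded part of a sublevel set of `f`
and one of `g` is a neighbourhood of the origin of the subspace. -/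
theorem eventually_exists_sub_eq {X : Type*} [NormedAddCommGroup X] [NormedSpace ℝ X]
    [CompleteSpace X] {f g : X → EReal} (hf : IsProper f) (hg : IsProper g)
    (hfc : IsConvex f) (hgc : IsConvex g) (hfl : LowerSemicontinuous f)
    (hgl : LowerSemicontinuous g) {L : Submodule ℝ X} [CompleteSpace L]
    (hL : (L : Set X) = posCone (effDom f - effDom g)) {x₀ : X} (hxf : x₀ ∈ effDom f)
    (hxg : x₀ ∈ effDom g) :
    ∃ a b R : ℝ, ∀ᶠ z : L in 𝓝 0, ∃ x y : X, f x ≤ a ∧ g y ≤ b ∧ ‖y‖ ≤ R ∧ (z : X) = x - y := by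
  have hcf := fun x (hx : x ∈ effDom f) => (EReal.coe_toReal (ne_of_lt hx) (hf.1 x)).ge
  have hcg := fun x (hx : x ∈ effDom g) => (EReal.coe_toReal (ne_of_lt hx) (hg.1 x)).ge
  set a := (f x₀).toReal + 1
  set b := (g x₀).toReal + 1
  set R := ‖x₀‖ + 1
  let G : Set ((X × X) × L) :=
    {p | p.1 ∈ ({x | f x ≤ (a : EReal)} ×ˢ {y | g y ≤ (b : EReal)}) ∩ Metric.closedBall 0 R} ∩
      {p | (p.2 : X) = p.1.1 - p.1.2}
  have hGc : Convex ℝ G := by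
    refine Convex.inter ?_ ?_
    · exact (((hfc.convex_sublevel a).prod (hgc.convex_sublevel b)).inter
        (convex_closedBall 0 R)).linear_preimage (LinearMap.fst ℝ (X × X) L)
    · rintro ⟨⟨x, y⟩, z⟩ h ⟨⟨x', y'⟩, z'⟩ h' s t - - -
      simp only [Set.mem_ofPred_eq] at h h'
      simp only [Set.mem_ofPred_eq, Prod.smul_mk, Prod.mk_add_mk, Submodule.coe_add,
        Submodule.coe_smul, h, h']
      module
  have hGcl : IsClosed G := by
    refine IsClosed.inter ?_ (isClosed_eq (by fun_prop) (by fun_prop))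
    exact (((hfl.isClosed_preimage _).prod (hgl.isClosed_preimage _)).inter
      Metric.isClosed_closedBall).preimage continuous_fst
  have hGR : ∀ p ∈ G, ‖p.1‖ ≤ R := fun p hp => mem_closedBall_zero_iff.1 hp.1.2
  have habs : ∀ z : L, ∃ t : ℝ, 0 < t ∧ t • z ∈ Prod.snd '' G := by
    intro z
    obtain ⟨c, hc, v, hv, hz⟩ : (z : X) ∈ posCone (effDom f - effDom g) := hL ▸ z.2
    obtain ⟨x, hx, y, hy, rfl⟩ := Set.mem_sub.1 hv
    -- Moving from `(x₀, x₀)` towards `(x, y)` gives difference `t • (x - y)`; the slack 1 in `a`,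
    -- `b`, `R` keeps small `t` admissible.
    have hnorm : ∀ᶠ t : ℝ in 𝓝[>] 0,
        ((1 - t) • x₀ + t • x, (1 - t) • x₀ + t • y) ∈ Metric.closedBall (0 : X × X) R := by
      have hcont : Continuous fun t : ℝ => ((1 - t) • x₀ + t • x, (1 - t) • x₀ + t • y) := by
        fun_prop
      refine ((hcont.tendsto 0).mono_left nhdsWithin_le_nhds).eventually
        (Metric.closedBall_mem_nhds_of_mem ?_)
      simp [R, Prod.norm_def]
    obtain ⟨t, ⟨⟨htf, htg⟩, htn⟩, ht⟩ :=
      ((((hfc.eventually_le (hcf x₀ hxf) (hcf x hx) (lt_add_one _)).and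
        (hgc.eventually_le (hcg x₀ hxg) (hcg y hy) (lt_add_one _))).and hnorm).and
        self_mem_nhdsWithin).exists
    have ht0 : 0 < t := ht
    refine ⟨t / c, div_pos ht0 hc, ⟨⟨((1 - t) • x₀ + t • x, (1 - t) • x₀ + t • y), (t / c) • z⟩,
      ⟨⟨⟨htf, htg⟩, htn⟩, ?_⟩, rfl⟩⟩
    simp only [Set.mem_ofPred_eq, Submodule.coe_smul, hz, smul_smul, div_mul_cancel₀ _ hc.ne']
    module
  refine ⟨a, b, R, ?_⟩
  filter_upwards [snd_image_mem_nhds_zero hGc hGcl hGR habs]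
  rintro _ ⟨⟨⟨x, y⟩, z⟩, ⟨⟨⟨hx, hy⟩, hn⟩, hz⟩, rfl⟩
  exact ⟨x, y, hx, hy, (norm_snd_le (x, y)).trans (mem_closedBall_zero_iff.1 hn), hz⟩

theorem exactConjugateSumRule_of_isClosedSubspace {X : Type*} [NormedAddCommGroup X]
    [NormedSpace ℝ X] [CompleteSpace X] {f g : X → EReal} (hf : IsProper f) (hg : IsProper g)
    (hfc : IsConvex f) (hgc : IsConvex g) (hfl : LowerSemicontinuous f)
    (hgl : LowerSemicontinuous g) (h : IsClosedSubspace (posCone (effDom f - effDom g))) :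
    ExactConjugateSumRule f g := by
  obtain ⟨hcl, L, hL⟩ := h
  obtain ⟨x₀, hxf, hxg⟩ : (effDom f ∩ effDom g).Nonempty := by
    have h0 : (0 : X) ∈ posCone (effDom f - effDom g) := hL ▸ L.zero_mem
    obtain ⟨t, ht, v, hv, htv⟩ := h0
    obtain ⟨x, hx, y, hy, rfl⟩ := Set.mem_sub.1 hv
    have hxy := (smul_eq_zero.1 htv.symm).resolve_left ht.ne'
    exact ⟨x, hx, sub_eq_zero.1 hxy ▸ hy⟩
  have hLcl : IsClosed (L : Set X) := hL ▸ hcl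
  have : CompleteSpace L := hLcl.completeSpace_coe
  obtain ⟨a, b, R, hnear⟩ := eventually_exists_sub_eq hf hg hfc hgc hfl hgl hL hxf hxg
  refine exactConjugateSumRule_of_split hf hg ⟨x₀, hxf, hxg⟩ fun φ m hm => ?_
  let j : L × ℝ →ₗ[ℝ] X × ℝ := L.subtype.prodMap LinearMap.id
  -- Separation takes place in `L × ℝ`; the bound `‖y‖ ≤ R` controls `-φ y`.
  obtain ⟨ψ, hψ⟩ := exists_affine_minorant
    (D := j ⁻¹' perturbation f g φ) ((convex_perturbation hfc hgc φ).linear_preimage j)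
    (fun z r s => perturbation_mono (z : X) r s)
    (fun r hr => neg_le_of_zero_mem_perturbation hf.1 hg.1 hm r hr) (M := a + b + ‖φ‖ * R)
    (by
      filter_upwards [hnear]
      rintro z ⟨x, y, hx, hy, hyR, hz⟩
      refine perturbation_mono (z : X) (a + b - φ y) _ ⟨x, y, a, b, hx, hy, hz, rfl⟩ ?_
      have h1 := (neg_le_abs (φ y)).trans (φ.le_opNorm y)
      have h2 := mul_le_mul_of_nonneg_left hyR (norm_nonneg φ)
      change a + b - φ y ≤ a + b + ‖φ‖ * R
      linarith)
  -- Any continuous extension works, since the perturbation set lies over `L`.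
  obtain ⟨Ψ, hΨ, -⟩ := exists_extension_norm_eq L ψ
  refine ⟨Ψ, φ - Ψ, by abel, conjugate_add_conjugate_le_of_perturbation hf hg fun z r hz => ?_⟩
  have hzL : z ∈ L := by
    obtain ⟨x, y, s, t, hx, hy, hxy, -⟩ := hz
    have : z ∈ posCone (effDom f - effDom g) :=
      ⟨1, one_pos, z, Set.mem_sub.2 ⟨x, hx.trans_lt (EReal.coe_lt_top _), y,
        hy.trans_lt (EReal.coe_lt_top _), hxy.symm⟩, (one_smul ℝ z).symm⟩
    rwa [← hL] at this
  have := hψ ⟨z, hzL⟩ r hz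
  rwa [← hΨ] at this

end FenchelSum

theorem theorem4p2 :
    -- (i) one function is continuous at a common point of the domains, in a separated LCTV space
    (∀ (X : Type*) [AddCommGroup X] [Module ℝ X] [TopologicalSpace X] [IsTopologicalAddGroup X]
        [ContinuousSMul ℝ X] [LocallyConvexSpace ℝ X] [T2Space X] (f g : X → EReal),
        FenchelSum.IsProper f → FenchelSum.IsProper g →
        FenchelSum.IsConvex f → FenchelSum.IsConvex g →
        (∃ x ∈ FenchelSum.effDom f ∩ FenchelSum.effDom g, ContinuousAt f x ∨ ContinuousAt g x) →
        FenchelSum.ExactConjugateSumRule f g) ∧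
    -- (ii) lower semicontinuous functions on a Banach space
    (∀ (X : Type*) [NormedAddCommGroup X] [NormedSpace ℝ X] [CompleteSpace X] (f g : X → EReal),
        FenchelSum.IsProper f → FenchelSum.IsProper g →
        FenchelSum.IsConvex f → FenchelSum.IsConvex g →
        LowerSemicontinuous f → LowerSemicontinuous g →
        FenchelSum.IsClosedSubspace
          (FenchelSum.posCone (FenchelSum.effDom f - FenchelSum.effDom g)) →
        FenchelSum.ExactConjugateSumRule f g) := by
  refine ⟨?_, ?_⟩
  · intro X _ _ _ _ _ _ _ f g hf hg hfc hgc h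
    exact FenchelSum.exactConjugateSumRule_of_continuousAt hf hg hfc hgc h
  · intro X _ _ _ f g hf hg hfc hgc hfl hgl h
    exact FenchelSum.exactConjugateSumRule_of_isClosedSubspace hf hg hfc hgc hfl hgl h
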